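/- Let $d\ge 1$ be an integer, $\sigma>0$, $\theta=(\theta_1,\dots,\theta_d)\in\mathbb R^d$, and let $\mathbf P_\theta$ (with expectation $\mathbf E_\theta$) be the law of the observations $y_j=\theta_j+\sigma\xi_j$, $j=1,\dots,d$, where $\xi_1,\dots,\xi_d$ are i.i.d. standard normal random variables. Let $L(\theta)=\sum_{i=1}^d\theta_i$. For an integer $1\le s\le d$ let $B_0(s)$ be the set of $\theta\in\mathbb R^d$ with at most $s$ non-zero components, and set $$\psi_\sigma^L(s,d)=\sigma^2s^2\log(1+d/s^2),\qquad R_L^*(B_0(s))=\inf_{\hat T}\sup_{\theta\in B_0(s)}\mathbf E_\theta(\hat T-L(\theta))^2,$$ where the infimum is over all estimators, that is, all measurable real-valued functions $\hat T$ of $(y_1,\dots,y_d)$. Let $$\hat L=\begin{cases}\sum_{j=1}^d y_j\,\mathbf 1_{\{|y_j|>\sigma\sqrt{2\log(1+d/s^2)}\}} & \text{if } s<\sqrt d,\\ \sum_{j=1}^d y_j & \text{if } s\ge\sqrt d.\end{cases}$$ There exist absolute constants $c>0$ and $C>0$ such that, for all integers $s,d$ with $1\le s\le d$ and all $\sigma>0$,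 the function $\hat L$ is an estimator (it is measurable) and $$\sup_{\theta\in B_0(s)}\mathbf E_\theta(\hat L-L(\theta))^2\le C\,\psi_\sigma^L(s,d),$$ $$c\,\psi_\sigma^L(s,d)\le R_L^*(B_0(s))\le C\,\psi_\sigma^L(s,d).$$ Moreover, with the same constants, for all such $s,d,\sigma$, $$c\,\min\bigl(\psi_\sigma^L(s,d),\sigma^2d\bigr)\le\psi_\sigma^L(s,d)\le C\,\min\bigl(\psi_\sigma^L(s,d),\sigma^2d\bigr),$$ $$c\,\min\bigl(\psi_\sigma^L(s,d),\sigma^2d\bigr)\le R_L^*(B_0(s))\le C\,\min\bigl(\psi_\sigma^L(s,d),\sigma^2d\bigr).$$ -/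

import Mathlib

open MeasureTheory ProbabilityTheory
open scoped ENNReal

noncomputable section

namespace SparseSequence

/-- The law `P_θ` of the observations `y_j = θ_j + σ ξ_j`, `j = 1, …, d`, where the `ξ_j` are
i.i.d. standard normal random variables. -/
def obsLaw {d : ℕ} (σ : ℝ) (θ : Fin d → ℝ) : Measure (Fin d → ℝ) :=
  (Measure.pi fun _ : Fin d => gaussianReal 0 1).map fun ξ j => θ j + σ * ξ j

/-- The linear functional `L(θ) = ∑ θ_i`. -/
def linFun {d : ℕ} (θ : Fin d → ℝ) : ℝ := ∑ i, θ i

/-- The class `B_0(s)` of vectors in `ℝ^d` with at most `s` non-zero components. -/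
def sparseClass (d s : ℕ) : Set (Fin d → ℝ) := {θ | hammingNorm θ ≤ s}

/-- The maximum squared risk `sup_{θ ∈ Θ} E_θ (That - T(θ))²`, with values in `[0, ∞]`. -/
def maxRisk {d : ℕ} (σ : ℝ) (T : (Fin d → ℝ) → ℝ) (Θ : Set (Fin d → ℝ))
    (That : (Fin d → ℝ) → ℝ) : ℝ≥0∞ :=
  ⨆ θ ∈ Θ, ∫⁻ y, ENNReal.ofReal ((That y - T θ) ^ 2) ∂(obsLaw σ θ)

/-- The minimax squared risk `R*_T(Θ)`: the infimum of the maximum squared risk over all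
estimators, i.e. all measurable real-valued functions of the observations. -/
def minimaxSqRisk {d : ℕ} (σ : ℝ) (T : (Fin d → ℝ) → ℝ) (Θ : Set (Fin d → ℝ)) : ℝ≥0∞ :=
  ⨅ (That : (Fin d → ℝ) → ℝ) (_ : Measurable That), maxRisk σ T Θ That

/-- The rate `ψ = σ² s² log (1 + d / s²)`. -/
def linRate (σ : ℝ) (s d : ℕ) : ℝ :=
  σ ^ 2 * (s : ℝ) ^ 2 * Real.log (1 + (d : ℝ) / (s : ℝ) ^ 2)

open Classical in
/-- The estimator of the linear functional: hard thresholding at the level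
`σ √(2 log (1 + d / s²))` if `s < √d`, and the sum of all observations if `s ≥ √d`. -/
def linEstimator {d : ℕ} (σ : ℝ) (s : ℕ) (y : Fin d → ℝ) : ℝ :=
  if (s : ℝ) < √(d : ℝ) then
    ∑ j, if σ * √(2 * Real.log (1 + (d : ℝ) / (s : ℝ) ^ 2)) < |y j| then y j else 0
  else ∑ j, y j

end SparseSequence

end

/-!
Lower bound: test `θ = 0` against the uniform mixture of the vectors that have a single entry `σ b`
in each of `s` disjoint blocks of `⌊d / s⌋` coordinates. With `b² = log (1 + d / s²)` the
chi-square distance of the mixture from the law at `0` is bounded by an absolute constant, because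
two such vectors drawn at random agree in few blocks, while `L` separates the two hypotheses by
`s σ b`.

Upper bound: for an odd coordinatewise rule only the at most `s` coordinates with `θ_j ≠ 0` are
biased, so the squared risk of the sum is at most `s` times their total risk plus the total risk of
all coordinates. At the threshold `σ x` with `x² = 2 log (1 + d / s²)` a null coordinate has risk
of order `σ² x² exp (-x² / 2)`, by comparison with the moments of Gaussians shifted by `± x`, and
the `d` null coordinates contribute no more than `ψ`. For `s ≥ √d` the rate is of order `σ² d`.
-/

open scoped NNReal

namespace SparseSequence

section TestingBound

variable {Ω E : Type*} [MeasurableSpace Ω] {μ : Measure Ω} [SeminormedAddCommGroup E]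
  {T : Ω → E} {a b : E} {K R : ℝ≥0∞}

lemma lintegral_mul_le_of_lintegral_sq_le {f g : Ω → ℝ≥0∞} {A B : ℝ≥0∞}
    (hf : AEMeasurable f μ) (hg : AEMeasurable g μ)
    (hfA : ∫⁻ x, f x ^ 2 ∂μ ≤ A ^ 2) (hgB : ∫⁻ x, g x ^ 2 ∂μ ≤ B ^ 2) :
    ∫⁻ x, f x * g x ∂μ ≤ A * B := by
  have sqrt_le {I C : ℝ≥0∞} (h : I ≤ C ^ 2) : I ^ (1 / 2 : ℝ) ≤ C := by
    rw [one_div, ENNReal.rpow_inv_le_iff two_pos]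
    simpa using h
  refine (ENNReal.lintegral_mul_le_Lp_mul_Lq μ Real.HolderConjugate.two_two hf hg).trans ?_
  simp_rw [ENNReal.rpow_two]
  exact mul_le_mul' (sqrt_le hfA) (sqrt_le hgB)

lemma enorm_sub_le_of_lintegral_sq_density_le {ℓ : Ω → ℝ≥0∞} (hℓ : AEMeasurable ℓ μ)
    (hT : AEStronglyMeasurable T μ) (hℓ_one : ∫⁻ x, ℓ x ∂μ = 1)
    (hℓ_sq : ∫⁻ x, ℓ x ^ 2 ∂μ ≤ K ^ 2) (ha : ∫⁻ x, ‖T x - a‖ₑ ^ 2 ∂μ ≤ R ^ 2)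
    (hb : ∫⁻ x, ℓ x * ‖T x - b‖ₑ ^ 2 ∂μ ≤ R ^ 2) :
    ‖a - b‖ₑ ≤ (1 + K) * R := by
  have hmeas (c : E) : AEMeasurable (fun x => ‖T x - c‖ₑ) μ :=
    (hT.sub aestronglyMeasurable_const).enorm
  have null_le : ∫⁻ x, ℓ x * ‖T x - a‖ₑ ∂μ ≤ K * R :=
    lintegral_mul_le_of_lintegral_sq_le hℓ (hmeas a) hℓ_sq ha
  have alt_le : ∫⁻ x, ℓ x * ‖T x - b‖ₑ ∂μ ≤ 1 * R := by
    have hac := withDensity_absolutelyContinuous μ ℓ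
    have := lintegral_mul_le_of_lintegral_sq_le (μ := μ.withDensity ℓ) (A := 1) (B := R)
      aemeasurable_const ((hmeas b).mono_ac hac) (f := fun _ => 1) (by simp [hℓ_one])
      (by rwa [lintegral_withDensity_eq_lintegral_mul₀ hℓ ((hmeas b).pow_const 2)])
    simp_rw [one_mul] at this ⊢
    rwa [lintegral_withDensity_eq_lintegral_mul₀ hℓ (hmeas b)] at this
  calc ‖a - b‖ₑ = ∫⁻ x, ℓ x * ‖a - b‖ₑ ∂μ := by
        rw [lintegral_mul_const'' _ hℓ, hℓ_one, one_mul]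
    _ ≤ ∫⁻ x, (ℓ x * ‖T x - b‖ₑ + ℓ x * ‖T x - a‖ₑ) ∂μ := by
        refine lintegral_mono fun x => ?_
        rw [← mul_add, ← sub_sub_sub_cancel_left b a (T x)]
        gcongr
        exact enorm_sub_le
    _ = ∫⁻ x, ℓ x * ‖T x - b‖ₑ ∂μ + ∫⁻ x, ℓ x * ‖T x - a‖ₑ ∂μ :=
        lintegral_add_left' (hℓ.mul (hmeas b)) _
    _ ≤ 1 * R + K * R := add_le_add alt_le null_le
    _ = (1 + K) * R := (add_mul _ _ _).symm

lemma enorm_sub_le_of_mixture {F : Type*} [Fintype F] [Nonempty F] {ℓ : F → Ω → ℝ≥0∞}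
    (hℓ : ∀ f, Measurable (ℓ f)) (hT : AEStronglyMeasurable T μ)
    (hℓ_one : ∀ f, ∫⁻ x, ℓ f x ∂μ = 1)
    (hℓ_mul : ∑ f, ∑ g, ∫⁻ x, ℓ f x * ℓ g x ∂μ ≤ (K * Fintype.card F) ^ 2)
    (ha : ∫⁻ x, ‖T x - a‖ₑ ^ 2 ∂μ ≤ R ^ 2)
    (hb : ∀ f, ∫⁻ x, ℓ f x * ‖T x - b‖ₑ ^ 2 ∂μ ≤ R ^ 2) :
    ‖a - b‖ₑ ≤ (1 + K) * R := by
  set N : ℝ≥0∞ := (Fintype.card F : ℝ≥0∞)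
  have hN : N⁻¹ * N = 1 :=
    ENNReal.inv_mul_cancel (by simp [N]) (ENNReal.natCast_ne_top _)
  have hNtop : N⁻¹ ≠ ∞ := by simp [N]
  refine enorm_sub_le_of_lintegral_sq_density_le (ℓ := fun x => N⁻¹ * ∑ f, ℓ f x)
    (by fun_prop) hT ?_ ?_ ha ?_
  · rw [lintegral_const_mul' _ _ hNtop, lintegral_finsetSum _ fun f _ => hℓ f]
    simpa [hℓ_one] using hN
  · calc ∫⁻ x, (N⁻¹ * ∑ f, ℓ f x) ^ 2 ∂μ
        = N⁻¹ ^ 2 * ∑ f, ∑ g, ∫⁻ x, ℓ f x * ℓ g x ∂μ := by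
          simp_rw [mul_pow, sq (∑ f, ℓ f _), Finset.sum_mul_sum]
          rw [lintegral_const_mul' _ _ (ENNReal.pow_ne_top hNtop),
            lintegral_finsetSum _ fun f _ => by fun_prop]
          congr! with f
          exact lintegral_finsetSum _ fun g _ => (hℓ f).mul (hℓ g)
      _ ≤ N⁻¹ ^ 2 * (K * N) ^ 2 := by gcongr
      _ = K ^ 2 := by rw [← mul_pow, mul_left_comm, hN, mul_one]
  · calc ∫⁻ x, N⁻¹ * (∑ f, ℓ f x) * ‖T x - b‖ₑ ^ 2 ∂μ
        = N⁻¹ * ∑ f, ∫⁻ x, ℓ f x * ‖T x - b‖ₑ ^ 2 ∂μ := by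
          simp_rw [mul_assoc, Finset.sum_mul]
          rw [lintegral_const_mul' _ _ hNtop, lintegral_finsetSum']
          exact fun f _ =>
            (hℓ f).aemeasurable.mul ((hT.sub aestronglyMeasurable_const).enorm.pow_const 2)
      _ ≤ N⁻¹ * ∑ _f : F, R ^ 2 := by gcongr with f; exact hb f
      _ = R ^ 2 := by
          rw [Finset.sum_const, nsmul_eq_mul, Finset.card_univ, ← mul_assoc, hN, one_mul]

end TestingBound

section GaussianShift

lemma gaussianReal_add_mul_eq_withDensity (m t : ℝ) {v : ℝ≥0} (hv : v ≠ 0) :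
    gaussianReal (m + v * t) v = (gaussianReal m v).withDensity fun x =>
      ENNReal.ofReal (Real.exp (t * (x - m) - v * t ^ 2 / 2)) := by
  rw [gaussianReal_of_var_ne_zero _ hv, gaussianReal_of_var_ne_zero _ hv,
    ← withDensity_mul _ (measurable_gaussianPDF m v) (by fun_prop)]
  congr 1
  ext x
  rw [Pi.mul_apply, gaussianPDF, gaussianPDF, ← ENNReal.ofReal_mul (gaussianPDFReal_nonneg _ _ _),
    gaussianPDFReal, gaussianPDFReal, mul_assoc (√_)⁻¹ (Real.exp _) (Real.exp _), ← Real.exp_add]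
  congr 3
  field_simp
  ring

lemma gaussianReal_one_eq_withDensity (t : ℝ) :
    gaussianReal t 1 = (gaussianReal 0 1).withDensity fun x =>
      ENNReal.ofReal (Real.exp (t * x - t ^ 2 / 2)) := by
  simpa using gaussianReal_add_mul_eq_withDensity 0 t one_ne_zero

lemma lintegral_pi_prod_eval {ι : Type*} [Fintype ι] {Ω : ι → Type*} [∀ i, MeasurableSpace (Ω i)]
    (μ : ∀ i, Measure (Ω i)) [∀ i, IsProbabilityMeasure (μ i)] {f : ∀ i, Ω i → ℝ≥0∞}
    (hf : ∀ i, Measurable (f i)) :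
    ∫⁻ x, ∏ i, f i (x i) ∂(Measure.pi μ) = ∏ i, ∫⁻ x, f i x ∂(μ i) := by
  rw [lintegral_prod_eq_prod_lintegral_of_indepFun Finset.univ (fun i (x : ∀ i, Ω i) => f i (x i))
    (iIndepFun_pi fun i => (hf i).aemeasurable) fun i => (hf i).comp (measurable_pi_apply i)]
  exact Finset.prod_congr rfl fun i _ => (measurePreserving_eval μ i).lintegral_comp (hf i)

lemma pi_withDensity {ι : Type*} [Fintype ι] {Ω : ι → Type*} [∀ i, MeasurableSpace (Ω i)]
    (μ : ∀ i, Measure (Ω i)) [∀ i, IsProbabilityMeasure (μ i)] {f : ∀ i, Ω i → ℝ≥0∞}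
    (hf : ∀ i, Measurable (f i)) [∀ i, SigmaFinite ((μ i).withDensity (f i))] :
    Measure.pi (fun i => (μ i).withDensity (f i)) =
      (Measure.pi μ).withDensity fun x => ∏ i, f i (x i) := by
  refine Measure.pi_eq fun s hs => ?_
  have hind (x : ∀ i, Ω i) : (Set.univ.pi s).indicator (fun x => ∏ i, f i (x i)) x =
      ∏ i, (s i).indicator (f i) (x i) := by
    have : ∏ i, (s i).indicator (f i) (x i) = _ :=
      prod_indicator_apply Finset.univ (fun i => Function.eval i ⁻¹' s i) (fun i x => f i (x i)) x
    simpa [Set.pi_def, Finset.prod_fn] using this.symm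
  rw [withDensity_apply _ (MeasurableSet.univ_pi hs),
    ← lintegral_indicator (MeasurableSet.univ_pi hs)]
  simp_rw [hind]
  rw [lintegral_pi_prod_eval μ fun i => (hf i).indicator (hs i)]
  simp_rw [lintegral_indicator (hs _), withDensity_apply _ (hs _)]

variable {ι : Type*} [Fintype ι]

/-- The standard normal law `N(0, I)` on `ℝ^ι`, encoded as a product measure because the observation
law `obsLaw` lives on a plain function space. -/
noncomputable abbrev stdGaussianPi (ι : Type*) [Fintype ι] : Measure (ι → ℝ) :=
  Measure.pi fun _ => gaussianReal 0 1

/-- The likelihood ratio of the normal law `N(h, I)` on `ℝ^ι` with respect to the standard normal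
law `N(0, I)`, with values in `[0, ∞]` so that it is a density for `Measure.withDensity`. -/
noncomputable def shiftDensity (h x : ι → ℝ) : ℝ≥0∞ :=
  ENNReal.ofReal (Real.exp (h ⬝ᵥ x - h ⬝ᵥ h / 2))

lemma measurable_shiftDensity (h : ι → ℝ) : Measurable (shiftDensity h) := by
  unfold shiftDensity dotProduct
  fun_prop

lemma shiftDensity_eq_prod (h x : ι → ℝ) :
    shiftDensity h x = ∏ i, ENNReal.ofReal (Real.exp (h i * x i - h i ^ 2 / 2)) := by
  rw [← ENNReal.ofReal_prod_of_nonneg fun i _ => (Real.exp_pos _).le, ← Real.exp_sum,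
    Finset.sum_sub_distrib, ← Finset.sum_div]
  simp_rw [sq, shiftDensity, dotProduct]

lemma shiftDensity_mul (h k x : ι → ℝ) :
    shiftDensity h x * shiftDensity k x =
      ENNReal.ofReal (Real.exp (h ⬝ᵥ k)) * shiftDensity (h + k) x := by
  simp only [shiftDensity, ← ENNReal.ofReal_mul (Real.exp_pos _).le, ← Real.exp_add,
    add_dotProduct, dotProduct_add, dotProduct_comm k h]
  ring_nf

lemma map_const_add_stdGaussianPi (h : ι → ℝ) :
    (stdGaussianPi ι).map (h + ·) = (stdGaussianPi ι).withDensity (shiftDensity h) := by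
  have coord (i : ι) : (gaussianReal 0 1).map (h i + ·) = (gaussianReal 0 1).withDensity
      fun x => ENNReal.ofReal (Real.exp (h i * x - h i ^ 2 / 2)) := by
    rw [gaussianReal_map_const_add, zero_add, gaussianReal_one_eq_withDensity]
  have (i : ι) : IsProbabilityMeasure ((gaussianReal 0 1).withDensity
      fun x => ENNReal.ofReal (Real.exp (h i * x - h i ^ 2 / 2))) := by
    rw [← coord]
    exact Measure.isProbabilityMeasure_map (by fun_prop)
  calc _ = Measure.pi fun i => (gaussianReal 0 1).map (h i + ·) :=
        Measure.pi_map_pi fun i => by fun_prop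
    _ = _ := by
        simp_rw [coord]
        rw [pi_withDensity _ fun i => by fun_prop]
        simp_rw [← shiftDensity_eq_prod]

lemma lintegral_const_add_stdGaussianPi (h : ι → ℝ) {g : (ι → ℝ) → ℝ≥0∞} (hg : Measurable g) :
    ∫⁻ x, g (h + x) ∂(stdGaussianPi ι) = ∫⁻ x, shiftDensity h x * g x ∂(stdGaussianPi ι) := by
  rw [← lintegral_map hg (measurable_const_add h), map_const_add_stdGaussianPi,
    lintegral_withDensity_eq_lintegral_mul _ (measurable_shiftDensity h) hg]
  rfl

lemma lintegral_shiftDensity (h : ι → ℝ) :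
    ∫⁻ x, shiftDensity h x ∂(stdGaussianPi ι) = 1 := by
  simpa using (lintegral_const_add_stdGaussianPi h (g := fun _ => 1) measurable_const).symm

lemma lintegral_shiftDensity_mul (h k : ι → ℝ) :
    ∫⁻ x, shiftDensity h x * shiftDensity k x ∂(stdGaussianPi ι) =
      ENNReal.ofReal (Real.exp (h ⬝ᵥ k)) := by
  simp_rw [shiftDensity_mul]
  rw [lintegral_const_mul' _ _ ENNReal.ofReal_ne_top, lintegral_shiftDensity, mul_one]

end GaussianShift


section MixtureLowerBound

variable {d : ℕ}

lemma lintegral_obsLaw (σ : ℝ) (θ : Fin d → ℝ) {g : (Fin d → ℝ) → ℝ≥0∞} (hg : Measurable g) :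
    ∫⁻ y, g y ∂(obsLaw σ θ) =
      ∫⁻ x, g (θ + σ • x) ∂(stdGaussianPi (Fin d)) :=
  lintegral_map hg (by fun_prop)

lemma ofReal_sq_eq_enorm_sq (x : ℝ) : ENNReal.ofReal (x ^ 2) = ‖x‖ₑ ^ 2 := by
  rw [← enorm_pow, Real.enorm_of_nonneg (sq_nonneg x)]

lemma le_minimaxSqRisk_of_mixture {F : Type*} [Fintype F] [Nonempty F] {σ K b : ℝ}
    {T : (Fin d → ℝ) → ℝ} {Θ : Set (Fin d → ℝ)} {θ₀ : Fin d → ℝ} {h : F → Fin d → ℝ}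
    (hθ₀ : θ₀ ∈ Θ) (hΘ : ∀ f, θ₀ + σ • h f ∈ Θ) (hT : ∀ f, T (θ₀ + σ • h f) = b) (hK : 0 ≤ K)
    (hexp : ∑ f, ∑ g, Real.exp (h f ⬝ᵥ h g) ≤ (K * Fintype.card F) ^ 2) :
    ENNReal.ofReal (((b - T θ₀) / (1 + K)) ^ 2) ≤ minimaxSqRisk σ T Θ := by
  refine le_iInf₂ fun That hThat => ?_
  set R : ℝ≥0∞ := maxRisk σ T Θ That ^ (1 / 2 : ℝ) with hR
  have hR_sq : R ^ 2 = maxRisk σ T Θ That := by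
    rw [hR, ← ENNReal.rpow_two, ← ENNReal.rpow_mul]
    norm_num
  have risk_le {θ : Fin d → ℝ} (hθ : θ ∈ Θ) :
      ∫⁻ x, ‖That (θ + σ • x) - T θ‖ₑ ^ 2 ∂(stdGaussianPi (Fin d)) ≤ R ^ 2 := by
    simp_rw [← ofReal_sq_eq_enorm_sq]
    rw [← lintegral_obsLaw σ θ (g := fun y => ENNReal.ofReal ((That y - T θ) ^ 2)) (by fun_prop),
      hR_sq]
    exact le_iSup₂_of_le θ hθ le_rfl
  have alt_le (f : F) : ∫⁻ x, shiftDensity (h f) x * ‖That (θ₀ + σ • x) - b‖ₑ ^ 2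
      ∂(stdGaussianPi (Fin d)) ≤ R ^ 2 := by
    rw [← lintegral_const_add_stdGaussianPi (h f)
      (g := fun x => ‖That (θ₀ + σ • x) - b‖ₑ ^ 2) (by fun_prop)]
    simpa only [smul_add, ← add_assoc, hT] using risk_le (hΘ f)
  have hexp' : ∑ f, ∑ g, ∫⁻ x, shiftDensity (h f) x * shiftDensity (h g) x
      ∂(stdGaussianPi (Fin d)) ≤ (ENNReal.ofReal K * Fintype.card F) ^ 2 := by
    simp_rw [lintegral_shiftDensity_mul]
    simp_rw [← ENNReal.ofReal_sum_of_nonneg fun _ _ => (Real.exp_pos _).le]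
    rw [← ENNReal.ofReal_sum_of_nonneg fun _ _ => Finset.sum_nonneg fun _ _ => (Real.exp_pos _).le,
      ← ENNReal.ofReal_natCast, ← ENNReal.ofReal_mul hK, ← ENNReal.ofReal_pow (by positivity)]
    exact ENNReal.ofReal_le_ofReal hexp
  have separation_le : ‖T θ₀ - b‖ₑ ≤ (1 + ENNReal.ofReal K) * R :=
    enorm_sub_le_of_mixture (T := fun x => That (θ₀ + σ • x))
      (fun f => measurable_shiftDensity (h f))
      (hThat.comp (by fun_prop)).aestronglyMeasurable
      (fun f => lintegral_shiftDensity (h f)) hexp' (risk_le hθ₀) alt_le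
  rw [ofReal_sq_eq_enorm_sq, ← hR_sq, div_eq_mul_inv, enorm_mul, enorm_inv (by positivity),
    ← div_eq_mul_inv, enorm_sub_rev, Real.enorm_of_nonneg (r := 1 + K) (by positivity),
    ENNReal.ofReal_add zero_le_one hK, ENNReal.ofReal_one]
  gcongr
  exact ENNReal.div_le_of_le_mul' separation_le

end MixtureLowerBound

section BlockVector

variable {ι κ ν : Type*} [Fintype ι] [DecidableEq ν] {e : ι × κ → ν}

/-- The vector that has the entry `b` at one position in each of the blocks `{e (i, k) | k}`,
namely at `e (i, f i)`, and is zero elsewhere. These are the alternatives of the lower bound. -/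
noncomputable def blockVector (e : ι × κ → ν) (b : ℝ) (f : ι → κ) : ν → ℝ :=
  ∑ i, Pi.single (e (i, f i)) b

variable [Fintype ν]

lemma sum_blockVector (e : ι × κ → ν) (b : ℝ) (f : ι → κ) :
    ∑ k, blockVector e b f k = Fintype.card ι * b := by
  simp_rw [blockVector, Finset.sum_apply]
  rw [Finset.sum_comm]
  simp

lemma hammingNorm_blockVector_le (e : ι × κ → ν) (b : ℝ) (f : ι → κ) :
    hammingNorm (blockVector e b f) ≤ Fintype.card ι := by
  refine (Finset.card_le_card (t := Finset.univ.image fun i => e (i, f i)) fun k hk => ?_).trans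
    Finset.card_image_le
  by_contra hk'
  simp_all [blockVector, Pi.single_apply, eq_comm]

lemma blockVector_dotProduct_blockVector [DecidableEq κ] (he : Function.Injective e) (b : ℝ)
    (f g : ι → κ) :
    blockVector e b f ⬝ᵥ blockVector e b g = ∑ i, if f i = g i then b ^ 2 else 0 := by
  classical
  simp_rw [blockVector, sum_dotProduct, dotProduct_sum, single_dotProduct, Pi.single_apply,
    he.eq_iff, Prod.mk.injEq, ite_and, mul_ite, mul_zero, Finset.sum_ite_eq, Finset.mem_univ,
    if_true, sq]

lemma sum_exp_blockVector_dotProduct [DecidableEq ι] [Fintype κ] [Nonempty κ]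
    (he : Function.Injective e) (b : ℝ) :
    ∑ f : ι → κ, ∑ g : ι → κ, Real.exp (blockVector e b f ⬝ᵥ blockVector e b g) =
      (1 + (Real.exp (b ^ 2) - 1) / Fintype.card κ) ^ Fintype.card ι *
        (Fintype.card (ι → κ) : ℝ) ^ 2 := by
  classical
  have sum_ite (k : κ) : ∑ l, Real.exp (if k = l then b ^ 2 else 0) =
      (1 + (Real.exp (b ^ 2) - 1) / Fintype.card κ) * Fintype.card κ := by
    have (l : κ) : Real.exp (if k = l then b ^ 2 else 0) =
        1 + if k = l then Real.exp (b ^ 2) - 1 else 0 := by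
      split_ifs <;> simp
    simp_rw [this, Finset.sum_add_distrib, Finset.sum_ite_eq, Finset.mem_univ, if_true]
    simp only [Finset.sum_const, Finset.card_univ, nsmul_eq_mul, mul_one]
    field_simp
  have sum_exp (f : ι → κ) : ∑ g, Real.exp (blockVector e b f ⬝ᵥ blockVector e b g) =
      (1 + (Real.exp (b ^ 2) - 1) / Fintype.card κ) ^ Fintype.card ι *
        Fintype.card (ι → κ) := by
    simp_rw [blockVector_dotProduct_blockVector he, Real.exp_sum]
    rw [← Fintype.prod_sum fun i l => Real.exp (if f i = l then b ^ 2 else 0)]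
    simp_rw [sum_ite]
    simp [mul_pow]
  simp_rw [sum_exp]
  simp only [Finset.sum_const, Finset.card_univ, nsmul_eq_mul]
  ring

end BlockVector

section LinearRate

variable {s d : ℕ}

lemma one_add_div_pow_le_nine (hs : 1 ≤ s) (hsd : s ≤ d) :
    (1 + (d : ℝ) / (s : ℝ) ^ 2 / ((d / s : ℕ) : ℝ)) ^ s ≤ 9 := by
  have hs0 : (0 : ℝ) < s := by exact_mod_cast hs
  have hm : 1 ≤ d / s := (Nat.one_le_div_iff hs).2 hsd
  have hm0 : (0 : ℝ) < ((d / s : ℕ) : ℝ) := by exact_mod_cast hm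
  have d_le : (d : ℝ) ≤ 2 * s * ((d / s : ℕ) : ℝ) := by
    have : d ≤ 2 * s * (d / s) := by nlinarith [Nat.lt_mul_div_succ d hs]
    exact_mod_cast this
  have div_le : (d : ℝ) / (s : ℝ) ^ 2 / ((d / s : ℕ) : ℝ) ≤ 2 / s := by
    rw [div_div, div_le_div_iff₀ (mul_pos (pow_pos hs0 2) hm0) hs0]
    nlinarith
  calc (1 + (d : ℝ) / (s : ℝ) ^ 2 / ((d / s : ℕ) : ℝ)) ^ s
      ≤ Real.exp (2 / s) ^ s := by
        gcongr
        linarith [Real.add_one_le_exp (2 / (s : ℝ))]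
    _ = Real.exp 1 ^ 2 := by
        rw [← Real.exp_nat_mul, ← Real.exp_nat_mul]
        congr 1
        field_simp
        norm_num
    _ ≤ 9 := by nlinarith [Real.exp_one_lt_d9, Real.exp_pos 1]

lemma log_one_add_div_sq_nonneg (s d : ℕ) : 0 ≤ Real.log (1 + (d : ℝ) / (s : ℝ) ^ 2) :=
  Real.log_nonneg (le_add_of_nonneg_right (by positivity))

lemma linRate_nonneg (σ : ℝ) (s d : ℕ) : 0 ≤ linRate σ s d :=
  mul_nonneg (by positivity) (log_one_add_div_sq_nonneg s d)

lemma linRate_le (σ : ℝ) (s d : ℕ) : linRate σ s d ≤ σ ^ 2 * d := by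
  rcases eq_or_ne s 0 with rfl | hs
  · simp [linRate, mul_nonneg, sq_nonneg]
  calc linRate σ s d ≤ σ ^ 2 * (s : ℝ) ^ 2 * (d / (s : ℝ) ^ 2) := by
        unfold linRate
        gcongr
        linarith [Real.log_le_sub_one_of_pos (x := 1 + (d : ℝ) / (s : ℝ) ^ 2) (by positivity)]
    _ = σ ^ 2 * d := by field_simp

lemma linRate_div_le_minimaxSqRisk (σ : ℝ) (hs : 1 ≤ s) (hsd : s ≤ d) :
    ENNReal.ofReal (linRate σ s d / 16) ≤ minimaxSqRisk σ linFun (sparseClass d s) := by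
  set b : ℝ := √(Real.log (1 + (d : ℝ) / (s : ℝ) ^ 2))
  have hb : b ^ 2 = Real.log (1 + (d : ℝ) / (s : ℝ) ^ 2) :=
    Real.sq_sqrt (log_one_add_div_sq_nonneg s d)
  let e : Fin s × Fin (d / s) → Fin d := Fin.castLE (Nat.mul_div_le d s) ∘ finProdFinEquiv
  have he : Function.Injective e := (Fin.castLE_injective _).comp finProdFinEquiv.injective
  have : Nonempty (Fin (d / s)) := ⟨⟨0, (Nat.one_le_div_iff hs).2 hsd⟩⟩
  have mem_sparseClass (f : Fin s → Fin (d / s)) :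
      0 + σ • blockVector e b f ∈ sparseClass d s := by
    have : hammingNorm (σ • blockVector e b f) ≤ hammingNorm (blockVector e b f) :=
      hammingNorm_smul_le_hammingNorm
    simpa [sparseClass] using this.trans (hammingNorm_blockVector_le e b f)
  have linFun_eq (f : Fin s → Fin (d / s)) : linFun (0 + σ • blockVector e b f) = σ * (s * b) := by
    simp [linFun, ← Finset.mul_sum, sum_blockVector]
  have sum_exp_le : ∑ f, ∑ g, Real.exp (blockVector e b f ⬝ᵥ blockVector e b g) ≤
      (3 * (Fintype.card (Fin s → Fin (d / s)) : ℝ)) ^ 2 := by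
    rw [sum_exp_blockVector_dotProduct he, mul_pow, hb, Real.exp_log (by positivity),
      add_sub_cancel_left, Fintype.card_fin, Fintype.card_fin]
    gcongr
    exact (one_add_div_pow_le_nine hs hsd).trans_eq (by norm_num)
  convert le_minimaxSqRisk_of_mixture (by simp [sparseClass]) mem_sparseClass linFun_eq
    zero_le_three sum_exp_le using 2
  rw [linRate, ← hb]
  simp only [linFun, Pi.zero_apply, Finset.sum_const_zero]
  ring

end LinearRate

section BiasVariance

lemma integral_sq_sum_le {Ω ι : Type*} {mΩ : MeasurableSpace Ω} {μ : Measure Ω}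
    [IsProbabilityMeasure μ] [Fintype ι] {X : ι → Ω → ℝ} {S : Finset ι}
    (hX : ∀ i, MemLp (X i) 2 μ) (hind : Pairwise fun i j => X i ⟂ᵢ[μ] X j)
    (hS : ∀ i ∉ S, ∫ ω, X i ω ∂μ = 0) :
    ∫ ω, (∑ i, X i ω) ^ 2 ∂μ ≤ S.card * ∑ i ∈ S, ∫ ω, X i ω ^ 2 ∂μ + ∑ i, ∫ ω, X i ω ^ 2 ∂μ := by
  have mean_eq : ∫ ω, ∑ i, X i ω ∂μ = ∑ i ∈ S, ∫ ω, X i ω ∂μ := by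
    rw [integral_finsetSum _ fun i _ => (hX i).integrable one_le_two]
    exact (Finset.sum_subset S.subset_univ fun i _ hi => hS i hi).symm
  have variance_le : Var[∑ i, X i; μ] ≤ ∑ i, ∫ ω, X i ω ^ 2 ∂μ := by
    rw [IndepFun.variance_sum (fun i _ => hX i) (hind.set_pairwise _)]
    exact Finset.sum_le_sum fun i _ => variance_le_expectation_sq (hX i).aestronglyMeasurable
  have sq_mean_le (i : ι) : (∫ ω, X i ω ∂μ) ^ 2 ≤ ∫ ω, X i ω ^ 2 ∂μ :=
    sub_nonneg.1 ((variance_nonneg _ _).trans_eq (variance_eq_sub (hX i)))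
  calc ∫ ω, (∑ i, X i ω) ^ 2 ∂μ = (∫ ω, ∑ i, X i ω ∂μ) ^ 2 + Var[∑ i, X i; μ] := by
        rw [variance_eq_sub (memLp_finsetSum' _ fun i _ => hX i)]
        simp
    _ ≤ S.card * ∑ i ∈ S, (∫ ω, X i ω ∂μ) ^ 2 + ∑ i, ∫ ω, X i ω ^ 2 ∂μ := by
        rw [mean_eq]
        exact add_le_add sq_sum_le_card_mul_sum_sq variance_le
    _ ≤ S.card * ∑ i ∈ S, ∫ ω, X i ω ^ 2 ∂μ + ∑ i, ∫ ω, X i ω ^ 2 ∂μ := by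
        gcongr with i
        exact sq_mean_le i

lemma lintegral_sq_sum_pi_le {ι : Type*} [Fintype ι] {Ω : ι → Type*}
    {mΩ : ∀ i, MeasurableSpace (Ω i)} {μ : ∀ i, Measure (Ω i)} [∀ i, IsProbabilityMeasure (μ i)]
    {X : ∀ i, Ω i → ℝ} {S : Finset ι}
    (hX : ∀ i, MemLp (X i) 2 (μ i)) (hS : ∀ i ∉ S, ∫ x, X i x ∂(μ i) = 0) :
    ∫⁻ x, ENNReal.ofReal ((∑ i, X i (x i)) ^ 2) ∂(Measure.pi μ) ≤
      ENNReal.ofReal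
        (S.card * ∑ i ∈ S, ∫ x, X i x ^ 2 ∂(μ i) + ∑ i, ∫ x, X i x ^ 2 ∂(μ i)) := by
  have hX_eval (i : ι) : MemLp (fun x : ∀ i, Ω i => X i (x i)) 2 (Measure.pi μ) :=
    (hX i).comp_measurePreserving (measurePreserving_eval μ i)
  have hind := iIndepFun_pi fun i => (hX i).aestronglyMeasurable.aemeasurable
  have integral_sq_eval (i : ι) :
      ∫ x, X i (x i) ^ 2 ∂(Measure.pi μ) = ∫ x, X i x ^ 2 ∂(μ i) :=
    integral_comp_eval (f := fun x => X i x ^ 2) ((hX i).aestronglyMeasurable.pow 2)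
  rw [← ofReal_integral_eq_lintegral_ofReal
    (memLp_finsetSum _ fun i _ => hX_eval i).integrable_sq (ae_of_all _ fun _ => sq_nonneg _)]
  simp_rw [← integral_sq_eval]
  refine ENNReal.ofReal_le_ofReal (integral_sq_sum_le hX_eval (fun i j hij => hind.indepFun hij) ?_)
  intro i hi
  rw [integral_comp_eval (hX i).aestronglyMeasurable, hS i hi]

lemma lintegral_sq_sum_sub_linFun_obsLaw_le {d : ℕ} {σ : ℝ} {θ : Fin d → ℝ} {g : ℝ → ℝ}
    {S : Finset (Fin d)} (hg : Measurable g)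
    (hg_memLp : ∀ j, MemLp (fun u => g (θ j + σ * u) - θ j) 2 (gaussianReal 0 1))
    (hS : ∀ j ∉ S, ∫ u, (g (θ j + σ * u) - θ j) ∂(gaussianReal 0 1) = 0) :
    ∫⁻ y, ENNReal.ofReal ((∑ j, g (y j) - linFun θ) ^ 2) ∂(obsLaw σ θ) ≤
      ENNReal.ofReal
        (S.card * ∑ j ∈ S, ∫ u, (g (θ j + σ * u) - θ j) ^ 2 ∂(gaussianReal 0 1) +
          ∑ j, ∫ u, (g (θ j + σ * u) - θ j) ^ 2 ∂(gaussianReal 0 1)) := by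
  rw [lintegral_obsLaw _ _ (by fun_prop)]
  simp_rw [linFun, ← Finset.sum_sub_distrib]
  exact lintegral_sq_sum_pi_le hg_memLp hS

end BiasVariance

section GaussianMoments

lemma integral_sq_gaussianReal (m : ℝ) (v : ℝ≥0) :
    ∫ x, x ^ 2 ∂(gaussianReal m v) = v + m ^ 2 := by
  have := variance_eq_sub (memLp_id_gaussianReal (μ := m) (v := v) 2)
  simp only [variance_id_gaussianReal, id_eq, integral_id_gaussianReal, Pi.pow_apply] at this
  linarith

lemma integrable_sq_mul_exp_gaussianReal (t : ℝ) :
    Integrable (fun u => u ^ 2 * Real.exp (t * u - t ^ 2 / 2)) (gaussianReal 0 1) := by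
  have : Integrable (fun u => u ^ 2) (gaussianReal t 1) := (memLp_id_gaussianReal 2).integrable_sq
  rw [gaussianReal_one_eq_withDensity,
    integrable_withDensity_iff_integrable_smul' (by fun_prop) (by simp)] at this
  simpa only [ENNReal.toReal_ofReal (Real.exp_pos _).le, smul_eq_mul, mul_comm] using this

lemma integral_sq_mul_exp_gaussianReal (t : ℝ) :
    ∫ u, u ^ 2 * Real.exp (t * u - t ^ 2 / 2) ∂(gaussianReal 0 1) = 1 + t ^ 2 := by
  have := integral_sq_gaussianReal t 1
  rw [gaussianReal_one_eq_withDensity,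
    integral_withDensity_eq_integral_toReal_smul (by fun_prop) (by simp)] at this
  simpa only [ENNReal.toReal_ofReal (Real.exp_pos _).le, smul_eq_mul, mul_comm, NNReal.coe_one]
    using this

lemma integral_gaussianReal_eq_zero_of_odd {f : ℝ → ℝ} (hf : f.Odd) (v : ℝ≥0) :
    ∫ u, f u ∂(gaussianReal 0 v) = 0 := by
  have map_neg : (gaussianReal 0 v).map (fun u => -u) = gaussianReal 0 v := by
    rw [gaussianReal_map_neg, neg_zero]
  have : ∫ u, f u ∂(gaussianReal 0 v) = -∫ u, f u ∂(gaussianReal 0 v) :=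
    calc ∫ u, f u ∂(gaussianReal 0 v) = ∫ u, f (-u) ∂(gaussianReal 0 v) := by
          conv_lhs => rw [← map_neg]
          exact (MeasurableEquiv.neg ℝ).measurableEmbedding.integral_map f
      _ = -∫ u, f u ∂(gaussianReal 0 v) := by simp_rw [hf _, integral_neg]
  linarith

end GaussianMoments

section HardThreshold

/-- Hard thresholding at level `τ`: the identity outside `[-τ, τ]`, and zero on `[-τ, τ]`. The
sparse case of `linEstimator` applies it to each observation. -/
noncomputable def hardThreshold (τ t : ℝ) : ℝ := if τ < |t| then t else 0

lemma measurable_hardThreshold (τ : ℝ) : Measurable (hardThreshold τ) :=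
  .ite (measurableSet_lt measurable_const measurable_abs) measurable_id measurable_const

lemma odd_hardThreshold (τ : ℝ) : (hardThreshold τ).Odd := fun t => by
  rw [hardThreshold, hardThreshold, abs_neg, neg_ite, neg_zero]

lemma abs_hardThreshold_le (τ t : ℝ) : |hardThreshold τ t| ≤ |t| := by
  unfold hardThreshold
  split_ifs <;> simp

lemma hardThreshold_mul_mul {σ : ℝ} (hσ : 0 < σ) (τ t : ℝ) :
    hardThreshold (σ * τ) (σ * t) = σ * hardThreshold τ t := by
  simp only [hardThreshold, abs_mul, abs_of_pos hσ, mul_lt_mul_iff_right₀ hσ, mul_ite, mul_zero]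

lemma sq_hardThreshold_sub_le (τ a t : ℝ) :
    (hardThreshold τ t - a) ^ 2 ≤ 2 * (τ ^ 2 + (t - a) ^ 2) := by
  unfold hardThreshold
  split_ifs with h
  · nlinarith [sq_nonneg (t - a), sq_nonneg τ]
  · have : t ^ 2 ≤ τ ^ 2 := sq_le_sq.2 ((not_lt.1 h).trans (le_abs_self τ))
    nlinarith [sq_nonneg (2 * t - a)]

lemma sq_hardThreshold_le {x : ℝ} (hx : 0 ≤ x) (u : ℝ) :
    hardThreshold x u ^ 2 ≤ Real.exp (-x ^ 2 / 2) *
      (u ^ 2 * Real.exp (x * u - x ^ 2 / 2) + u ^ 2 * Real.exp (-x * u - (-x) ^ 2 / 2)) := by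
  have rhs_eq : Real.exp (-x ^ 2 / 2) *
      (u ^ 2 * Real.exp (x * u - x ^ 2 / 2) + u ^ 2 * Real.exp (-x * u - (-x) ^ 2 / 2)) =
      u ^ 2 * (Real.exp (x * (u - x)) + Real.exp (x * (-u - x))) := by
    rw [← mul_add, mul_left_comm, mul_add (Real.exp _), ← Real.exp_add, ← Real.exp_add]
    ring_nf
  rw [rhs_eq, hardThreshold]
  split_ifs with h
  · have one_le : 1 ≤ Real.exp (x * (u - x)) + Real.exp (x * (-u - x)) := by
      rcases lt_abs.1 h with h | h
      · have := Real.one_le_exp (mul_nonneg hx (sub_nonneg.2 h.le))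
        linarith [Real.exp_pos (x * (-u - x))]
      · have := Real.one_le_exp (mul_nonneg hx (sub_nonneg.2 h.le))
        linarith [Real.exp_pos (x * (u - x))]
    exact le_mul_of_one_le_right (sq_nonneg u) one_le
  · rw [zero_pow two_ne_zero]
    positivity

lemma memLp_hardThreshold_gaussianReal (τ m : ℝ) (v : ℝ≥0) :
    MemLp (hardThreshold τ) 2 (gaussianReal m v) :=
  (memLp_id_gaussianReal 2).mono (measurable_hardThreshold τ).aestronglyMeasurable
    (ae_of_all _ fun u => abs_hardThreshold_le τ u)

lemma integral_sq_hardThreshold_gaussianReal_le {x : ℝ} (hx : 0 ≤ x) :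
    ∫ u, hardThreshold x u ^ 2 ∂(gaussianReal 0 1) ≤
      2 * (x ^ 2 + 1) * Real.exp (-x ^ 2 / 2) := by
  have hpos := integrable_sq_mul_exp_gaussianReal x
  have hneg := integrable_sq_mul_exp_gaussianReal (-x)
  refine (integral_mono (memLp_hardThreshold_gaussianReal x 0 1).integrable_sq
    ((hpos.add hneg).const_mul _) (sq_hardThreshold_le hx)).trans_eq ?_
  rw [integral_const_mul, integral_add' hpos hneg, integral_sq_mul_exp_gaussianReal,
    integral_sq_mul_exp_gaussianReal]
  ring

lemma integral_sq_hardThreshold_mul_le {σ x : ℝ} (hσ : 0 < σ) (hx : 0 ≤ x) :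
    ∫ u, hardThreshold (σ * x) (σ * u) ^ 2 ∂(gaussianReal 0 1) ≤
      2 * σ ^ 2 * (x ^ 2 + 1) * Real.exp (-x ^ 2 / 2) := by
  simp_rw [hardThreshold_mul_mul hσ, mul_pow]
  rw [integral_const_mul]
  exact (mul_le_mul_of_nonneg_left (integral_sq_hardThreshold_gaussianReal_le hx)
    (sq_nonneg σ)).trans_eq (by ring)

lemma integral_hardThreshold_mul_eq_zero (τ σ : ℝ) :
    ∫ u, hardThreshold τ (σ * u) ∂(gaussianReal 0 1) = 0 :=
  integral_gaussianReal_eq_zero_of_odd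
    (fun u => by rw [mul_neg, odd_hardThreshold]) 1

lemma memLp_hardThreshold_add_mul_sub (τ a σ : ℝ) :
    MemLp (fun u => hardThreshold τ (a + σ * u) - a) 2 (gaussianReal 0 1) := by
  have : MemLp (fun u => a + σ * u) 2 (gaussianReal 0 1) :=
    (memLp_const a).add ((memLp_id_gaussianReal 2).const_mul σ)
  refine (this.mono ((measurable_hardThreshold τ).comp (by fun_prop)).aestronglyMeasurable
    (ae_of_all _ fun u => abs_hardThreshold_le τ _)).sub (memLp_const a)

lemma integral_sq_hardThreshold_sub_le (τ a σ : ℝ) :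
    ∫ u, (hardThreshold τ (a + σ * u) - a) ^ 2 ∂(gaussianReal 0 1) ≤ 2 * (τ ^ 2 + σ ^ 2) := by
  have integrable_sq : Integrable (fun u : ℝ => u ^ 2) (gaussianReal 0 1) :=
    (memLp_id_gaussianReal 2).integrable_sq
  calc ∫ u, (hardThreshold τ (a + σ * u) - a) ^ 2 ∂(gaussianReal 0 1)
      ≤ ∫ u, 2 * (τ ^ 2 + σ ^ 2 * u ^ 2) ∂(gaussianReal 0 1) := by
        refine integral_mono (memLp_hardThreshold_add_mul_sub τ a σ).integrable_sq (by fun_prop)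
          fun u => ?_
        simpa only [add_sub_cancel_left, mul_pow] using sq_hardThreshold_sub_le τ a (a + σ * u)
    _ = 2 * (τ ^ 2 + σ ^ 2) := by
        rw [integral_const_mul, integral_add (integrable_const _) (integrable_sq.const_mul _),
          integral_const_mul, integral_sq_gaussianReal]
        simp

end HardThreshold

section RiskBounds

variable {s d : ℕ} {σ : ℝ}

lemma lintegral_sq_sum_hardThreshold_sub_linFun_le (hσ : 0 < σ) {x : ℝ} (hx : 0 ≤ x)
    (θ : Fin d → ℝ) :
    ∫⁻ y, ENNReal.ofReal ((∑ j, hardThreshold (σ * x) (y j) - linFun θ) ^ 2) ∂(obsLaw σ θ) ≤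
      ENNReal.ofReal (2 * σ ^ 2 * (x ^ 2 + 1) *
        (hammingNorm θ ^ 2 + hammingNorm θ + d * Real.exp (-x ^ 2 / 2))) := by
  set S : Finset (Fin d) := {j | θ j ≠ 0} with hS
  have hS_card : S.card = hammingNorm θ := rfl
  have eq_zero {j : Fin d} (hj : j ∉ S) : θ j = 0 := by simpa [hS] using hj
  have bias_zero (j : Fin d) (hj : j ∉ S) :
      ∫ u, (hardThreshold (σ * x) (θ j + σ * u) - θ j) ∂(gaussianReal 0 1) = 0 := by
    simp_rw [eq_zero hj, zero_add, sub_zero, integral_hardThreshold_mul_eq_zero]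
  set r : Fin d → ℝ := fun j =>
    ∫ u, (hardThreshold (σ * x) (θ j + σ * u) - θ j) ^ 2 ∂(gaussianReal 0 1) with hr
  have risk_le (j : Fin d) : r j ≤ 2 * σ ^ 2 * (x ^ 2 + 1) :=
    (integral_sq_hardThreshold_sub_le _ _ _).trans_eq (by ring)
  have risk_le_of_notMem (j : Fin d) (hj : j ∉ S) :
      r j ≤ 2 * σ ^ 2 * (x ^ 2 + 1) * Real.exp (-x ^ 2 / 2) := by
    simpa only [hr, eq_zero hj, zero_add, sub_zero] using integral_sq_hardThreshold_mul_le hσ hx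
  have sum_le : ∑ j ∈ S, r j ≤ S.card * (2 * σ ^ 2 * (x ^ 2 + 1)) := by
    simpa using Finset.sum_le_card_nsmul S r _ fun j _ => risk_le j
  have sum_compl_le :
      ∑ j ∈ Sᶜ, r j ≤ d * (2 * σ ^ 2 * (x ^ 2 + 1) * Real.exp (-x ^ 2 / 2)) := by
    calc ∑ j ∈ Sᶜ, r j ≤ Sᶜ.card * (2 * σ ^ 2 * (x ^ 2 + 1) * Real.exp (-x ^ 2 / 2)) := by
          simpa using Finset.sum_le_card_nsmul Sᶜ r _ fun j hj =>
            risk_le_of_notMem j (Finset.mem_compl.1 hj)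
      _ ≤ d * (2 * σ ^ 2 * (x ^ 2 + 1) * Real.exp (-x ^ 2 / 2)) := by
          gcongr
          exact (Finset.card_le_univ _).trans_eq (Fintype.card_fin d)
  refine (lintegral_sq_sum_sub_linFun_obsLaw_le (measurable_hardThreshold _)
    (fun j => memLp_hardThreshold_add_mul_sub _ _ _) bias_zero).trans
    (ENNReal.ofReal_le_ofReal ?_)
  calc S.card * ∑ j ∈ S, r j + ∑ j, r j
      = S.card * ∑ j ∈ S, r j + ∑ j ∈ S, r j + ∑ j ∈ Sᶜ, r j := by
        rw [← Finset.sum_add_sum_compl S, add_assoc]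
    _ ≤ S.card * (S.card * (2 * σ ^ 2 * (x ^ 2 + 1))) + S.card * (2 * σ ^ 2 * (x ^ 2 + 1)) +
        d * (2 * σ ^ 2 * (x ^ 2 + 1) * Real.exp (-x ^ 2 / 2)) := by gcongr
    _ = _ := by rw [hS_card]; ring

lemma maxRisk_sum_le (σ : ℝ) (Θ : Set (Fin d → ℝ)) :
    maxRisk σ linFun Θ (fun y => ∑ j, y j) ≤ ENNReal.ofReal (σ ^ 2 * d) := by
  refine iSup₂_le fun θ _ => ?_
  have hmemLp : MemLp (fun u => σ * u) 2 (gaussianReal 0 1) :=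
    (memLp_id_gaussianReal 2).const_mul σ
  have := lintegral_sq_sum_sub_linFun_obsLaw_le (σ := σ) (θ := θ) (S := ∅) measurable_id
    (fun j => by simpa using hmemLp)
    (fun j _ => by
      simp only [id_eq, add_sub_cancel_left]
      rw [integral_const_mul, integral_id_gaussianReal, mul_zero])
  refine this.trans_eq (congrArg ENNReal.ofReal ?_)
  simp [mul_pow, integral_const_mul, integral_sq_gaussianReal, mul_comm]

lemma linEstimator_of_lt_sqrt (σ : ℝ) (h : (s : ℝ) < √d) :
    linEstimator σ s = fun y : Fin d → ℝ =>
      ∑ j, hardThreshold (σ * √(2 * Real.log (1 + (d : ℝ) / (s : ℝ) ^ 2))) (y j) :=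
  funext fun _ => if_pos h

lemma linEstimator_of_sqrt_le (σ : ℝ) (h : √d ≤ (s : ℝ)) :
    linEstimator σ s = fun y : Fin d → ℝ => ∑ j, y j :=
  funext fun _ => if_neg h.not_gt

lemma measurable_linEstimator (σ : ℝ) (s : ℕ) :
    Measurable (linEstimator (d := d) σ s) := by
  rcases lt_or_ge (s : ℝ) (√d) with h | h
  · rw [linEstimator_of_lt_sqrt σ h]
    exact Finset.measurable_fun_sum _ fun j _ =>
      (measurable_hardThreshold _).comp (measurable_pi_apply j)
  · rw [linEstimator_of_sqrt_le σ h]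
    fun_prop

lemma maxRisk_linEstimator_le_of_lt_sqrt (hs : 1 ≤ s) (hσ : 0 < σ) (h : (s : ℝ) < √d) :
    maxRisk σ linFun (sparseClass d s) (linEstimator σ s) ≤
      ENNReal.ofReal (24 * linRate σ s d) := by
  have one_le_s : (1 : ℝ) ≤ s := mod_cast hs
  set l := Real.log (1 + (d : ℝ) / (s : ℝ) ^ 2) with hl
  have one_le_two_mul_l : 1 ≤ 2 * l := by
    have : 1 ≤ (d : ℝ) / (s : ℝ) ^ 2 :=
      (one_le_div₀ (by positivity)).2 ((Real.lt_sqrt (by positivity)).1 h).le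
    have : Real.log 2 ≤ l := Real.log_le_log two_pos (by linarith)
    linarith [Real.log_two_gt_d9]
  have d_mul_exp_le : (d : ℝ) * Real.exp (-(2 * l) / 2) ≤ (s : ℝ) ^ 2 := by
    rw [neg_div, mul_div_cancel_left₀ _ two_ne_zero, Real.exp_neg, hl,
      Real.exp_log (by positivity), mul_inv_le_iff₀ (by positivity), mul_add,
      mul_div_cancel₀ _ (by positivity)]
    linarith [sq_nonneg (s : ℝ)]
  rw [linEstimator_of_lt_sqrt σ h]
  refine iSup₂_le fun θ (hθ : hammingNorm θ ≤ s) =>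
    (lintegral_sq_sum_hardThreshold_sub_linFun_le hσ (Real.sqrt_nonneg _) θ).trans
      (ENNReal.ofReal_le_ofReal ?_)
  rw [Real.sq_sqrt (by linarith)]
  calc 2 * σ ^ 2 * (2 * l + 1) *
        (hammingNorm θ ^ 2 + hammingNorm θ + d * Real.exp (-(2 * l) / 2))
      ≤ 2 * σ ^ 2 * (2 * l + 2 * l) * ((s : ℝ) ^ 2 + (s : ℝ) ^ 2 + (s : ℝ) ^ 2) := by
        have : (hammingNorm θ : ℝ) ≤ s := mod_cast hθ
        have : (hammingNorm θ : ℝ) ≤ (s : ℝ) ^ 2 := this.trans (le_self_pow₀ one_le_s two_ne_zero)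
        gcongr
    _ = 24 * linRate σ s d := by rw [linRate, ← hl]; ring

lemma mul_le_two_mul_linRate (σ : ℝ) (hs : 1 ≤ s) (h : √d ≤ (s : ℝ)) :
    σ ^ 2 * d ≤ 2 * linRate σ s d := by
  set x := (d : ℝ) / (s : ℝ) ^ 2 with hx
  have x_nonneg : 0 ≤ x := by positivity
  have x_le_one : x ≤ 1 :=
    div_le_one_of_le₀ ((Real.sqrt_le_left (by positivity)).1 h) (by positivity)
  have x_le : x ≤ 2 * Real.log (1 + x) := by
    have : x / 2 ≤ 2 * x / (x + 2) := by
      rw [div_le_div_iff₀ two_pos (by positivity)]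
      nlinarith
    linarith [Real.le_log_one_add_of_nonneg x_nonneg]
  calc σ ^ 2 * d = σ ^ 2 * s ^ 2 * x := by rw [hx]; field_simp
    _ ≤ σ ^ 2 * s ^ 2 * (2 * Real.log (1 + x)) := by gcongr
    _ = 2 * linRate σ s d := by rw [linRate, ← hx]; ring

lemma maxRisk_linEstimator_le (hs : 1 ≤ s) (hσ : 0 < σ) :
    maxRisk σ linFun (sparseClass d s) (linEstimator σ s) ≤
      ENNReal.ofReal (24 * linRate σ s d) := by
  rcases lt_or_ge (s : ℝ) (√d) with h | h
  · exact maxRisk_linEstimator_le_of_lt_sqrt hs hσ h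
  · rw [linEstimator_of_sqrt_le σ h]
    refine (maxRisk_sum_le σ _).trans (ENNReal.ofReal_le_ofReal ?_)
    linarith [mul_le_two_mul_linRate σ hs h, linRate_nonneg σ s d]

end RiskBounds

end SparseSequence

theorem theorem1 :
    ∃ c C : ℝ, 0 < c ∧ 0 < C ∧ ∀ (s d : ℕ) (σ : ℝ), 1 ≤ s → s ≤ d → 0 < σ →
      -- the estimator attains the rate
      Measurable (SparseSequence.linEstimator (d := d) σ s) ∧
      SparseSequence.maxRisk σ SparseSequence.linFun (SparseSequence.sparseClass d s)
          (SparseSequence.linEstimator σ s)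
        ≤ ENNReal.ofReal (C * SparseSequence.linRate σ s d) ∧
      -- the minimax risk is of the order of the rate
      ENNReal.ofReal (c * SparseSequence.linRate σ s d)
        ≤ SparseSequence.minimaxSqRisk σ SparseSequence.linFun (SparseSequence.sparseClass d s) ∧
      SparseSequence.minimaxSqRisk σ SparseSequence.linFun (SparseSequence.sparseClass d s)
        ≤ ENNReal.ofReal (C * SparseSequence.linRate σ s d) ∧
      -- equivalent form of the rate
      c * min (SparseSequence.linRate σ s d) (σ ^ 2 * (d : ℝ)) ≤ SparseSequence.linRate σ s d ∧
      SparseSequence.linRate σ s d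
        ≤ C * min (SparseSequence.linRate σ s d) (σ ^ 2 * (d : ℝ)) ∧
      ENNReal.ofReal (c * min (SparseSequence.linRate σ s d) (σ ^ 2 * (d : ℝ)))
        ≤ SparseSequence.minimaxSqRisk σ SparseSequence.linFun (SparseSequence.sparseClass d s) ∧
      SparseSequence.minimaxSqRisk σ SparseSequence.linFun (SparseSequence.sparseClass d s)
        ≤ ENNReal.ofReal (C * min (SparseSequence.linRate σ s d) (σ ^ 2 * (d : ℝ))) := by
  refine ⟨1 / 16, 24, by norm_num, by norm_num, fun s d σ hs hsd hσ => ?_⟩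
  have nonneg := SparseSequence.linRate_nonneg σ s d
  have measurable := SparseSequence.measurable_linEstimator (d := d) σ s
  have risk_le := SparseSequence.maxRisk_linEstimator_le (d := d) hs hσ
  have upper : SparseSequence.minimaxSqRisk σ SparseSequence.linFun
      (SparseSequence.sparseClass d s) ≤ ENNReal.ofReal (24 * SparseSequence.linRate σ s d) :=
    (iInf₂_le _ measurable).trans risk_le
  have lower := SparseSequence.linRate_div_le_minimaxSqRisk σ hs hsd
  rw [div_eq_inv_mul, ← one_div] at lower
  rw [min_eq_left (SparseSequence.linRate_le σ s d)]
  exact ⟨measurable, risk_le, lower, upper, by linarith, by linarith, lower, upper⟩
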